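/- Let $Fm$ be the set of formulas built from a countably infinite set of propositional variables with the connectives $*,\to,\bar 0$ of Basic Logic and two unary connectives $\square,\lozenge$, with the usual abbreviations $\neg\varphi:=\varphi\to\bar 0$, $\bar 1:=\bar 0\to\bar 0$, $\varphi\wedge\psi:=\varphi*(\varphi\to\psi)$, $\varphi\vee\psi:=((\varphi\to\psi)\to\psi)\wedge((\psi\to\varphi)\to\varphi)$, $\varphi\equiv\psi:=(\varphi\to\psi)\wedge(\psi\to\varphi)$, and $\varphi^0:=\bar 1$, $\varphi^1:=\varphi$, $\varphi^{n+1}:=\varphi^n*\varphi$ for $n\ge 1$. The calculus $\mathrm{S5}(\mathcal L)$ has as axioms all instances in $Fm$ of the axiom schemata of infinite-valued Łukasiewicz logic (Hájek's axioms of Basic Logic together with $\neg\neg\varphi\to\varphi$) and all formulas $$\square\varphi\to\varphi,\quad \varphi\to\lozenge\varphi,\quad \square(\nu\to\varphi)\to(\nu\to\square\varphi),\quad \square(\varphi\to\nu)\to(\lozenge\varphi\to\nu),$$ $$\square(\varphi\vee\nu)\to(\square\varphi\vee\nu),\quad \lozenge(\varphi*\varphi)\equiv(\lozenge\varphi)*(\lozenge\varphi),$$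 where $\varphi$ is any formula and $\nu$ is any propositional combination of formulas beginning with $\square$ or $\lozenge$; its rules are Modus Ponens (from $\varphi$ and $\varphi\to\psi$ infer $\psi$) and Necessitation (from $\varphi$ infer $\square\varphi$). Let $\mathrm{S5}(\mathcal L)_\infty$ be the extension of $\mathrm{S5}(\mathcal L)$ by the infinitary rule - $\square\mathrm{Inf}$: from $\square\varphi\vee(\square\alpha\to(\square\beta)^n)$ for every $n\in\mathbb N$, infer $\square\varphi\vee(\square\alpha\to\square\alpha*\square\beta)$, and let $\mathrm{S5}(\mathcal L)_\infty'$ be the extension of $\mathrm{S5}(\mathcal L)$ by Kułacka's infinitary rule - $\mathrm{Inf}$: from $\varphi\vee(\alpha\to\beta^n)$ for every $n\in\mathbb N$, infer $\varphi\vee(\alpha\to\alpha*\beta)$. For either calculus and $\Gamma\cup\{\varphi\}\subseteq Fm$, write $\Gamma\vdash\varphi$ if there are an ordinal $\xi$ and a family of formulas $(\psi_i)_{i\le\xi}$ with $\psi_\xi=\varphi$ such that, for each $i\le\xi$, $\psi_i$ is an axiom, or belongs to $\Gamma$, or is the conclusion of an instance of a rule all of whose premises lie in $\{\psi_j:j<i\}$.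 **Theorem.** For every $\Gamma\cup\{\varphi\}\subseteq Fm$, $$\Gamma\vdash_{\mathrm{S5}(\mathcal L)_\infty}\varphi\quad\text{if and only if}\quad\Gamma\vdash_{\mathrm{S5}(\mathcal L)_\infty'}\varphi.$$ -/

import Mathlib

/-- Formulas of the S5-modal language over the language of Basic Logic. The propositional variables
are indexed by `ℕ`. The primitive connectives of Basic Logic are the constant `bot`, the strong
conjunction `star` and the implication `imp`. -/
inductive Fm : Type
  | var : ℕ → Fm
  | bot : Fm
  | star : Fm → Fm → Fm
  | imp : Fm → Fm → Fm
  | box : Fm → Fm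
  | dia : Fm → Fm

namespace Fm

/-- Negation `¬ φ := φ → 0`. -/
def neg (φ : Fm) : Fm := φ.imp bot

/-- The constant `1 := 0 → 0`. -/
def top : Fm := bot.imp bot

/-- Weak (lattice) conjunction `φ ∧ ψ := φ * (φ → ψ)`. -/
def and (φ ψ : Fm) : Fm := φ.star (φ.imp ψ)

/-- Weak (lattice) disjunction `φ ∨ ψ := ((φ → ψ) → ψ) ∧ ((ψ → φ) → φ)`. -/
def or (φ ψ : Fm) : Fm := ((φ.imp ψ).imp ψ).and ((ψ.imp φ).imp φ)

/-- `φ ≡ ψ` abbreviates `(φ → ψ) ∧ (ψ → φ)`. -/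
def equiv (φ ψ : Fm) : Fm := (φ.imp ψ).and (ψ.imp φ)

/-- Powers with respect to strong conjunction: `φ ^ 0 = 1`, `φ ^ 1 = φ`,
`φ ^ (n + 1) = φ ^ n * φ`. -/
def pow (φ : Fm) : ℕ → Fm
  | 0 => top
  | 1 => φ
  | n + 2 => (φ.pow (n + 1)).star φ

/-- Propositional combinations of formulas beginning with `box` or `dia`. -/
inductive IsModalComb : Fm → Prop
  | box (φ : Fm) : IsModalComb φ.box
  | dia (φ : Fm) : IsModalComb φ.dia
  | bot : IsModalComb Fm.bot
  | star {μ ν : Fm} : IsModalComb μ → IsModalComb ν → IsModalComb (μ.star ν)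
  | imp {μ ν : Fm} : IsModalComb μ → IsModalComb ν → IsModalComb (μ.imp ν)

/-- Instances (in the modal language) of the axiom schemata of infinite-valued Łukasiewicz logic:
Hájek's axioms of Basic Logic together with `¬ ¬ φ → φ`. -/
inductive LukAxiom : Fm → Prop
  | suffixing (φ ψ χ : Fm) : LukAxiom ((φ.imp ψ).imp ((ψ.imp χ).imp (φ.imp χ)))
  | weakening (φ ψ : Fm) : LukAxiom ((φ.star ψ).imp φ)
  | commutativity (φ ψ : Fm) : LukAxiom ((φ.star ψ).imp (ψ.star φ))
  | divisibility (φ ψ : Fm) : LukAxiom ((φ.star (φ.imp ψ)).imp (ψ.star (ψ.imp φ)))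
  | importation (φ ψ χ : Fm) : LukAxiom ((φ.imp (ψ.imp χ)).imp ((φ.star ψ).imp χ))
  | exportation (φ ψ χ : Fm) : LukAxiom (((φ.star ψ).imp χ).imp (φ.imp (ψ.imp χ)))
  | prelinearity (φ ψ χ : Fm) :
      LukAxiom (((φ.imp ψ).imp χ).imp (((ψ.imp φ).imp χ).imp χ))
  | explosion (φ : Fm) : LukAxiom (bot.imp φ)
  | involution (φ : Fm) : LukAxiom (φ.neg.neg.imp φ)

/-- The axioms of `S5(Ł)`. -/
inductive S5Axiom : Fm → Prop
  | luk {φ : Fm} : LukAxiom φ → S5Axiom φ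
  | box_elim (φ : Fm) : S5Axiom (φ.box.imp φ)
  | dia_intro (φ : Fm) : S5Axiom (φ.imp φ.dia)
  | box_imp_right (φ : Fm) {ν : Fm} : IsModalComb ν →
      S5Axiom ((ν.imp φ).box.imp (ν.imp φ.box))
  | box_imp_left (φ : Fm) {ν : Fm} : IsModalComb ν →
      S5Axiom ((φ.imp ν).box.imp (φ.dia.imp ν))
  | box_or (φ : Fm) {ν : Fm} : IsModalComb ν →
      S5Axiom ((φ.or ν).box.imp (φ.box.or ν))
  | dia_star (φ : Fm) : S5Axiom ((φ.star φ).dia.equiv (φ.dia.star φ.dia))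

/-- Instances of the inference rules of `S5(Ł)`: `S5Rule P φ` says that `φ` is the lower formula of
an instance whose set of upper formulas is `P`. -/
inductive S5Rule : Set Fm → Fm → Prop
  | modusPonens (φ ψ : Fm) : S5Rule {φ, φ.imp ψ} ψ
  | necessitation (φ : Fm) : S5Rule {φ} φ.box

/-- Instances of the infinitary rule `□Inf`. -/
inductive BoxInfRule : Set Fm → Fm → Prop
  | mk (φ α β : Fm) :
      BoxInfRule (Set.range fun n : ℕ => φ.box.or (α.box.imp (β.box.pow n)))
        (φ.box.or (α.box.imp (α.box.star β.box)))

/-- Instances of the unrestricted infinitary rule `Inf`. -/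
inductive InfRule : Set Fm → Fm → Prop
  | mk (φ α β : Fm) :
      InfRule (Set.range fun n : ℕ => φ.or (α.imp (β.pow n))) (φ.or (α.imp (α.star β)))

/-- `IsProof R Γ ξ s φ`: the family `s i`, `i ≤ ξ`, is a proof (of length `ξ`) of `φ` from `Γ` in
the calculus with the axioms of `S5(Ł)` and the inference rules `R`. Only the values of `s` at
ordinals `i ≤ ξ` matter. -/
def IsProof (R : Set Fm → Fm → Prop) (Γ : Set Fm) (ξ : Ordinal.{0}) (s : Ordinal.{0} → Fm)
    (φ : Fm) : Prop :=
  s ξ = φ ∧ ∀ i ≤ ξ, S5Axiom (s i) ∨ s i ∈ Γ ∨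
    ∃ P : Set Fm, R P (s i) ∧ P ⊆ s '' Set.Iio i

/-- Derivability from `Γ` in the calculus with the axioms of `S5(Ł)` and the inference rules `R`. -/
def Derivable (R : Set Fm → Fm → Prop) (Γ : Set Fm) (φ : Fm) : Prop :=
  ∃ (ξ : Ordinal.{0}) (s : Ordinal.{0} → Fm), IsProof R Γ ξ s φ

/-- Consequence in `S5(Ł)_∞`, the extension of `S5(Ł)` by the rule `□Inf`. -/
def S5LukInf (Γ : Set Fm) (φ : Fm) : Prop :=
  Derivable (fun P ψ => S5Rule P ψ ∨ BoxInfRule P ψ) Γ φ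

/-- Consequence in `S5(Ł)_∞'`, the extension of `S5(Ł)` by the rule `Inf`. -/
def S5LukInf' (Γ : Set Fm) (φ : Fm) : Prop :=
  Derivable (fun P ψ => S5Rule P ψ ∨ InfRule P ψ) Γ φ

end Fm

/-!
In an MV-algebra `a → a * b` is `¬a ∨ b`, so the value of the conclusion of `Inf` is
`c = f ∨ ¬a ∨ b`, and the premises give `¬c ≤ c ^ n` for all `n`. This property passes from `c` to
`□c`. Indeed, by prelinearity it yields `¬(c ^ m) ≤ c ^ m`, that is, `¬(c ^ m)` squares to `0`;
since `◇` preserves squares, so does `◇¬(c ^ m) = ¬□(c ^ m)`. When `m` is a power of two, moreover,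
`□(c ^ m) ≤ (□c) ^ m`, because `◇((c → □c) ^ m) = (◇(c → □c)) ^ m = 1`. Hence `□Inf` applies to
`□¬□c = ¬□c` and `□c` and gives `¬□c ≤ ¬□c * □c = 0`, so `c = 1`.

This argument lives in the Lindenbaum algebra of a theory, and transfinite derivability from `Γ` is
membership in every theory that includes `Γ` and is closed under the rules.
-/

/-- Bounded commutative integral residuated monoids: `a ⇨ b` is the residuum of the multiplication
(not of the meet), and the unit is the greatest element. -/
class ResiduatedMonoid (A : Type*) extends CommMonoid A, PartialOrder A, OrderBot A, HImp A where
  le_himp_iff_mul_le {a b c : A} : a ≤ b ⇨ c ↔ a * b ≤ c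
  le_one (a : A) : a ≤ 1

namespace ResiduatedMonoid

variable {A : Type*} [ResiduatedMonoid A] {a b c d : A}

instance : Compl A := ⟨fun a => a ⇨ ⊥⟩

theorem himp_bot_eq_compl (a : A) : a ⇨ ⊥ = aᶜ := rfl

theorem himp_mul_le (a b : A) : (a ⇨ b) * a ≤ b := le_himp_iff_mul_le.1 le_rfl

theorem mul_himp_le (a b : A) : a * (a ⇨ b) ≤ b := mul_comm a _ ▸ himp_mul_le a b

instance : IsOrderedMonoid A where
  mul_le_mul_left _ _ h _ := le_himp_iff_mul_le.1 (h.trans (le_himp_iff_mul_le.2 le_rfl))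

theorem one_le_iff_eq_one : 1 ≤ a ↔ a = 1 := (le_one a).ge_iff_eq

theorem mul_le_left (a b : A) : a * b ≤ a := mul_le_of_le_one_right' (le_one b)

theorem mul_le_right (a b : A) : a * b ≤ b := mul_le_of_le_one_left' (le_one a)

theorem self_le_himp (a b : A) : b ≤ a ⇨ b := le_himp_iff_mul_le.2 (mul_le_left b a)

theorem himp_mono (hba : b ≤ a) (hcd : c ≤ d) : a ⇨ c ≤ b ⇨ d :=
  le_himp_iff_mul_le.2 <|
    calc (a ⇨ c) * b ≤ (a ⇨ c) * a := by gcongr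
      _ ≤ c := himp_mul_le a c
      _ ≤ d := hcd

theorem himp_eq_one_iff : a ⇨ b = 1 ↔ a ≤ b := by
  rw [← one_le_iff_eq_one, le_himp_iff_mul_le, one_mul]

theorem one_himp (a : A) : 1 ⇨ a = a :=
  le_antisymm (by simpa only [one_mul] using mul_himp_le 1 a) (self_le_himp 1 a)

theorem himp_himp_eq_mul_himp (a b c : A) : a ⇨ (b ⇨ c) = a * b ⇨ c :=
  eq_of_forall_le_iff fun d => by simp only [le_himp_iff_mul_le, mul_assoc]

theorem himp_compl_eq_compl_mul (a b : A) : a ⇨ bᶜ = (a * b)ᶜ := himp_himp_eq_mul_himp a b ⊥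

theorem le_compl_iff_mul_eq_bot : a ≤ bᶜ ↔ a * b = ⊥ := le_himp_iff_mul_le.trans le_bot_iff

theorem compl_le_compl_of_le (h : a ≤ b) : bᶜ ≤ aᶜ := himp_mono h le_rfl

theorem compl_mul_eq_bot (a : A) : aᶜ * a = ⊥ := le_compl_iff_mul_eq_bot.1 le_rfl

theorem compl_bot_eq_one : (⊥ : A)ᶜ = 1 := himp_eq_one_iff.2 le_rfl

theorem compl_le_himp (a b : A) : aᶜ ≤ a ⇨ b := himp_mono le_rfl bot_le

end ResiduatedMonoid

/-- The algebras of Basic Logic, presented by Hájek's divisibility and prelinearity axioms. -/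
class BLAlgebra (A : Type*) extends ResiduatedMonoid A where
  divisibility (a b : A) : a * (a ⇨ b) ≤ b * (b ⇨ a)
  prelinearity (a b c : A) : (a ⇨ b) ⇨ c ≤ ((b ⇨ a) ⇨ c) ⇨ c

namespace BLAlgebra

open ResiduatedMonoid

variable {A : Type*} [BLAlgebra A] {a b c : A}

instance : SemilatticeInf A where
  inf a b := a * (a ⇨ b)
  inf_le_left a b := mul_le_left a _
  inf_le_right := mul_himp_le
  le_inf a b c hab hac :=
    calc a = a * (a ⇨ b) := by rw [himp_eq_one_iff.2 hab, mul_one]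
      _ ≤ b * (b ⇨ a) := divisibility a b
      _ ≤ b * (b ⇨ c) := mul_le_mul_right (himp_mono le_rfl hac) b

theorem mul_himp_eq_inf (a b : A) : a * (a ⇨ b) = a ⊓ b := rfl

theorem eq_one_of_himp_le (hab : a ⇨ b ≤ c) (hba : b ⇨ a ≤ c) : c = 1 := by
  have h := prelinearity a b c
  rwa [himp_eq_one_iff.2 hab, himp_eq_one_iff.2 hba, one_himp, one_le_iff_eq_one] at h

instance : Lattice A where
  sup a b := ((a ⇨ b) ⇨ b) ⊓ ((b ⇨ a) ⇨ a)
  le_sup_left a b := le_inf (le_himp_iff_mul_le.2 (mul_himp_le a b)) (self_le_himp _ a)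
  le_sup_right a b := le_inf (self_le_himp _ b) (le_himp_iff_mul_le.2 (mul_himp_le b a))
  sup_le a b c hac hbc := by
    refine himp_eq_one_iff.1 (eq_one_of_himp_le (a := a) (b := b) ?_ ?_) <;>
      rw [le_himp_iff_mul_le]
    · exact (mul_le_mul_right inf_le_left _).trans ((mul_himp_le _ b).trans hbc)
    · exact (mul_le_mul_right inf_le_right _).trans ((mul_himp_le _ a).trans hac)

theorem le_of_himp_pow_le_himp {n : ℕ} (h : (a ⇨ b) ^ n ≤ b ⇨ a) : b ≤ a := by
  induction n with
  | zero => rwa [pow_zero, one_le_iff_eq_one, himp_eq_one_iff] at h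
  | succ n ih =>
    refine ih ?_
    calc (a ⇨ b) ^ n ≤ (a ⇨ b) ⇨ (b ⇨ a) := by rwa [le_himp_iff_mul_le, ← pow_succ]
      _ ≤ ((b ⇨ a) ⇨ (b ⇨ a)) ⇨ (b ⇨ a) := prelinearity a b _
      _ = b ⇨ a := by rw [himp_eq_one_iff.2 le_rfl, one_himp]

end BLAlgebra

/-- MV-algebras, the algebras of Łukasiewicz logic, as the involutive BL-algebras. -/
class MVAlgebra (A : Type*) extends BLAlgebra A where
  involution (a : A) : aᶜᶜ ≤ a

namespace MVAlgebra

open ResiduatedMonoid BLAlgebra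

variable {A : Type*} [MVAlgebra A] {a b c f : A}

theorem compl_compl_eq (a : A) : aᶜᶜ = a :=
  le_antisymm (involution a) (le_himp_iff_mul_le.2 (mul_himp_le a ⊥))

theorem compl_le_swap (h : aᶜ ≤ b) : bᶜ ≤ a :=
  compl_compl_eq a ▸ compl_le_compl_of_le h

theorem le_compl_swap (h : a ≤ bᶜ) : b ≤ aᶜ :=
  compl_compl_eq b ▸ compl_le_compl_of_le h

theorem himp_eq_compl_mul_compl (a b : A) : a ⇨ b = (a * bᶜ)ᶜ := by
  rw [← himp_compl_eq_compl_mul, compl_compl_eq]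

theorem himp_mul_eq_compl_inf (a b : A) : a ⇨ a * b = (a ⊓ bᶜ)ᶜ :=
  calc a ⇨ a * b = a ⇨ (a ⇨ bᶜ)ᶜ := by rw [himp_compl_eq_compl_mul a b, compl_compl_eq]
    _ = (a ⊓ bᶜ)ᶜ := himp_compl_eq_compl_mul a (a ⇨ bᶜ)

theorem compl_le_iff_compl_mul_self_eq_bot : aᶜ ≤ a ↔ aᶜ * aᶜ = ⊥ := by
  rw [← le_compl_iff_mul_eq_bot, compl_compl_eq]

theorem compl_pow_le_pow (h : ∀ n : ℕ, aᶜ ≤ a ^ n) (n : ℕ) : (a ^ n)ᶜ ≤ a ^ n := by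
  refine le_of_himp_pow_le_himp (n := n) ?_
  calc (a ^ n ⇨ (a ^ n)ᶜ) ^ n ≤ a ^ n := by
        refine pow_le_pow_left' ?_ n
        rw [himp_compl_eq_compl_mul, ← pow_add]
        exact compl_le_swap (h _)
    _ ≤ (a ^ n)ᶜ ⇨ a ^ n := self_le_himp _ _

theorem compl_le_pow_of_sup_eq_one {n : ℕ} (h : f ⊔ (a ⇨ b ^ n) = 1) (hf : f ≤ c) (ha : aᶜ ≤ c)
    (hb : b ≤ c) : cᶜ ≤ c ^ n := by
  rw [← himp_eq_one_iff, ← one_le_iff_eq_one, ← h]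
  refine sup_le ?_ (himp_mono (compl_le_swap ha) (pow_le_pow_left' hb n))
  calc f ≤ c := hf
    _ = cᶜᶜ := (compl_compl_eq c).symm
    _ ≤ cᶜ ⇨ c ^ n := compl_le_himp _ _

end MVAlgebra

/-- MV-algebras with an S5 universal quantifier `box`. The existential quantifier is not primitive:
it is the dual `a ↦ (box aᶜ)ᶜ`, and the last axiom says that this dual preserves squares. -/
class S5MVAlgebra (A : Type*) extends MVAlgebra A where
  box : A → A
  box_le (a : A) : box a ≤ a
  box_box_himp (a b : A) : box (box a ⇨ b) = box a ⇨ box b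
  compl_box_compl_mul_self (a : A) : (box (a * a)ᶜ)ᶜ = (box aᶜ)ᶜ * (box aᶜ)ᶜ

namespace S5MVAlgebra

open ResiduatedMonoid BLAlgebra MVAlgebra

variable {A : Type*} [S5MVAlgebra A] {a b : A}

/-- The existential quantifier, dual to `box`. -/
def dia (a : A) : A := (box aᶜ)ᶜ

theorem box_one : box (1 : A) = 1 := by
  have h := box_box_himp (1 : A) 1
  rwa [himp_eq_one_iff.2 (box_le 1), himp_eq_one_iff.2 le_rfl] at h

theorem box_eq_one_iff : box a = 1 ↔ a = 1 :=
  ⟨fun h => one_le_iff_eq_one.1 (h ▸ box_le a), by rintro rfl; exact box_one⟩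

theorem box_le_box_iff : box a ≤ box b ↔ box a ≤ b := by
  rw [← himp_eq_one_iff, ← himp_eq_one_iff, ← box_box_himp, box_eq_one_iff]

theorem box_mono (h : a ≤ b) : box a ≤ box b := box_le_box_iff.2 ((box_le a).trans h)

theorem box_bot : box (⊥ : A) = ⊥ := le_bot_iff.1 (box_le ⊥)

theorem box_compl_box (a : A) : box (box a)ᶜ = (box a)ᶜ := by
  rw [← himp_bot_eq_compl, box_box_himp, box_bot]

theorem box_compl_box_himp (a b : A) : box ((box a)ᶜ ⇨ b) = (box a)ᶜ ⇨ box b := by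
  simpa only [box_compl_box] using box_box_himp (box a)ᶜ b

theorem dia_box (a : A) : dia (box a) = box a := by rw [dia, box_compl_box, compl_compl_eq]

theorem box_dia (a : A) : box (dia a) = dia a := box_compl_box aᶜ

theorem dia_compl (a : A) : dia aᶜ = (box a)ᶜ := by rw [dia, compl_compl_eq]

theorem dia_mono (h : a ≤ b) : dia a ≤ dia b :=
  compl_le_compl_of_le (box_mono (compl_le_compl_of_le h))

theorem dia_bot : dia (⊥ : A) = ⊥ := by simpa only [box_bot] using dia_box (⊥ : A)

theorem dia_mul_self (a : A) : dia (a * a) = dia a * dia a := compl_box_compl_mul_self a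

theorem dia_pow_two_pow (a : A) (k : ℕ) : dia (a ^ 2 ^ k) = dia a ^ 2 ^ k := by
  induction k with
  | zero => rw [pow_zero, pow_one, pow_one]
  | succ k ih => rw [pow_succ, pow_mul, pow_two, dia_mul_self, ih, ← pow_two, ← pow_mul]

theorem box_box_pow_two_pow (a : A) (k : ℕ) : box (box a ^ 2 ^ k) = box a ^ 2 ^ k := by
  have h : dia (box a ^ 2 ^ k) = box a ^ 2 ^ k := by rw [dia_pow_two_pow, dia_box]
  rw [← h, box_dia]

theorem box_mul_compl_box (a : A) : box (a * (box a)ᶜ) = ⊥ := by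
  set d := box a
  set m := box (a * dᶜ)
  have himp_le : dᶜ ⇨ m ≤ d :=
    calc dᶜ ⇨ m = box (dᶜ ⇨ a * dᶜ) := (box_compl_box_himp a _).symm
      _ ≤ box a := by
          refine box_mono ?_
          rw [mul_comm, himp_mul_eq_compl_inf, inf_eq_right.2 (compl_le_compl_of_le (box_le a)),
            compl_compl_eq]
  refine le_bot_iff.1 ?_
  calc m ≤ dᶜ ⊓ m := le_inf ((box_le _).trans (mul_le_right a dᶜ)) le_rfl
    _ = dᶜ * (dᶜ ⇨ m) := (mul_himp_eq_inf _ _).symm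
    _ ≤ dᶜ * d := mul_le_mul_right himp_le dᶜ
    _ = ⊥ := compl_mul_eq_bot d

theorem dia_himp_box_eq_one (a : A) : dia (a ⇨ box a) = 1 := by
  rw [himp_eq_compl_mul_compl, dia_compl, box_mul_compl_box, compl_bot_eq_one]

theorem box_pow_two_pow_le (a : A) (k : ℕ) : box (a ^ 2 ^ k) ≤ box a ^ 2 ^ k := by
  set m := 2 ^ k
  have himp_pow_le : (a ⇨ box a) ^ m ≤ box (a ^ m) ⇨ box a ^ m := by
    rw [le_himp_iff_mul_le]
    calc (a ⇨ box a) ^ m * box (a ^ m) ≤ (a ⇨ box a) ^ m * a ^ m := by gcongr; exact box_le _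
      _ = ((a ⇨ box a) * a) ^ m := (mul_pow ..).symm
      _ ≤ box a ^ m := pow_le_pow_left' (himp_mul_le a _) m
  have dia_himp : dia (box (a ^ m) ⇨ box a ^ m) = box (a ^ m) ⇨ box a ^ m := by
    rw [← box_box_pow_two_pow, ← box_box_himp, dia_box]
  rw [← himp_eq_one_iff, ← one_le_iff_eq_one, ← dia_himp]
  calc 1 = dia ((a ⇨ box a) ^ m) := by rw [dia_pow_two_pow, dia_himp_box_eq_one, one_pow]
    _ ≤ dia (box (a ^ m) ⇨ box a ^ m) := dia_mono himp_pow_le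

theorem compl_box_le_box (h : aᶜ ≤ a) : (box a)ᶜ ≤ box a := by
  rw [compl_le_iff_compl_mul_self_eq_bot] at h ⊢
  rw [← dia_compl, ← dia_mul_self, h, dia_bot]

theorem compl_box_le_box_pow (h : ∀ n : ℕ, aᶜ ≤ a ^ n) (n : ℕ) : (box a)ᶜ ≤ box a ^ n := by
  have pow_le : a ^ 2 ^ n ≤ a := by
    simpa only [pow_one] using pow_le_pow_right_of_le_one' (le_one a) (Nat.one_le_two_pow (n := n))
  calc (box a)ᶜ ≤ (box (a ^ 2 ^ n))ᶜ := compl_le_compl_of_le (box_mono pow_le)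
    _ ≤ box (a ^ 2 ^ n) := compl_box_le_box (compl_pow_le_pow h _)
    _ ≤ box a ^ 2 ^ n := box_pow_two_pow_le a n
    _ ≤ box a ^ n := pow_le_pow_right_of_le_one' (le_one _) Nat.lt_two_pow_self.le

variable (A) in
/-- Validity of the rule `Inf` in an algebra. -/
def SatisfiesInf : Prop :=
  ∀ f a b : A, (∀ n : ℕ, f ⊔ (a ⇨ b ^ n) = 1) → f ⊔ (a ⇨ a * b) = 1

variable (A) in
/-- Validity of the rule `□Inf` in an algebra. -/
def SatisfiesBoxInf : Prop :=
  ∀ f a b : A, (∀ n : ℕ, box f ⊔ (box a ⇨ box b ^ n) = 1) → box f ⊔ (box a ⇨ box a * box b) = 1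

theorem SatisfiesBoxInf.eq_one_of_forall_compl_le_pow (hA : SatisfiesBoxInf A)
    (h : ∀ n : ℕ, aᶜ ≤ a ^ n) : a = 1 := by
  have key := hA ⊥ (box a)ᶜ a fun n => by
    rw [box_compl_box, himp_eq_one_iff.2 (compl_box_le_box_pow h n), box_bot, bot_sup_eq]
  rw [box_compl_box, compl_mul_eq_bot, himp_bot_eq_compl, compl_compl_eq, box_bot,
    bot_sup_eq] at key
  exact box_eq_one_iff.1 key

theorem satisfiesBoxInf_iff_satisfiesInf : SatisfiesBoxInf A ↔ SatisfiesInf A := by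
  refine ⟨fun hA f a b h => hA.eq_one_of_forall_compl_le_pow fun n => ?_,
    fun hA f a b => hA (box f) (box a) (box b)⟩
  rw [himp_mul_eq_compl_inf]
  refine compl_le_pow_of_sup_eq_one (h n) le_sup_left (le_sup_of_le_right ?_)
    (le_sup_of_le_right ?_)
  · exact compl_le_compl_of_le inf_le_left
  · exact le_compl_swap inf_le_right

end S5MVAlgebra

namespace Fm

theorem IsModalComb.neg {ν : Fm} (hν : IsModalComb ν) : IsModalComb ν.neg := hν.imp .bot

/-- Closure of a set of formulas under the rules `R`, a rule being a relation between the set of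
upper formulas and the lower formula, as in `S5Rule`. -/
def ClosedUnder (R : Set Fm → Fm → Prop) (T : Set Fm) : Prop :=
  ∀ ⦃P : Set Fm⦄ ⦃φ : Fm⦄, R P φ → P ⊆ T → φ ∈ T

theorem closedUnder_or_iff {R R' : Set Fm → Fm → Prop} {T : Set Fm} :
    ClosedUnder (fun P φ => R P φ ∨ R' P φ) T ↔ ClosedUnder R T ∧ ClosedUnder R' T := by
  simp only [ClosedUnder, or_imp, forall_and]

section Derivable

variable {R : Set Fm → Fm → Prop} {Γ : Set Fm} {φ : Fm}

theorem Derivable.mem_of_closedUnder {T : Set Fm} (hax : ∀ ψ, S5Axiom ψ → ψ ∈ T) (hΓ : Γ ⊆ T)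
    (hR : ClosedUnder R T) (h : Derivable R Γ φ) : φ ∈ T := by
  obtain ⟨ξ, s, rfl, hs⟩ := h
  suffices ∀ i ≤ ξ, s i ∈ T from this ξ le_rfl
  intro i
  induction i using WellFoundedLT.induction with
  | ind i ih =>
    intro hi
    rcases hs i hi with h | h | ⟨P, hP, hPs⟩
    · exact hax _ h
    · exact hΓ h
    · refine hR hP fun χ hχ => ?_
      obtain ⟨j, hji, rfl⟩ := hPs hχ
      exact ih j hji (hji.le.trans hi)

theorem derivable_of_isWellFounded {α : Type} {r : α → α → Prop} [IsWellFounded α r] (f : α → Fm)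
    (hf : ∀ a, S5Axiom (f a) ∨ f a ∈ Γ ∨ ∃ P : Set Fm, R P (f a) ∧ P ⊆ f '' {b | r b a})
    (a : α) : Derivable R Γ (f a) := by
  obtain ⟨lt, hlt, _⟩ := IsWellFounded.exists_well_order_ge r
  let pos : α → Ordinal.{0} := Ordinal.typein lt
  let s : Ordinal.{0} → Fm := Function.extend pos f fun _ => bot
  have s_pos (b : α) : s (pos b) = f b := (Ordinal.typein_injective lt).extend_apply f _ b
  refine ⟨pos a, s, s_pos a, fun i hi => ?_⟩
  obtain ⟨b, rfl⟩ := Ordinal.typein_surj lt (hi.trans_lt (Ordinal.typein_lt_type lt a))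
  change S5Axiom (s (pos b)) ∨ s (pos b) ∈ Γ ∨ ∃ P, R P (s (pos b)) ∧ P ⊆ s '' Set.Iio (pos b)
  rw [s_pos]
  refine (hf b).imp_right (Or.imp_right fun ⟨P, hP, hPf⟩ => ⟨P, hP, fun χ hχ => ?_⟩)
  obtain ⟨c, hc, rfl⟩ := hPf hχ
  exact ⟨pos c, (Ordinal.typein_lt_typein lt).2 (hlt _ _ hc), s_pos c⟩

/-- Well-founded proof trees, possibly infinitely branching. They are data rather than a
proposition so that the nodes of a tree can be listed in a transfinite proof. -/
inductive ProofTree (R : Set Fm → Fm → Prop) (Γ : Set Fm) : Fm → Type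
  | ax {φ : Fm} : S5Axiom φ → ProofTree R Γ φ
  | hyp {φ : Fm} : φ ∈ Γ → ProofTree R Γ φ
  | rule {P : Set Fm} {φ : Fm} : R P φ → (∀ ψ ∈ P, ProofTree R Γ ψ) → ProofTree R Γ φ

namespace ProofTree

/-- The immediate subtree relation. -/
inductive IsChild : (Σ φ, ProofTree R Γ φ) → (Σ φ, ProofTree R Γ φ) → Prop
  | mk {P : Set Fm} {φ ψ : Fm} (hP : R P φ) (t : ∀ ψ ∈ P, ProofTree R Γ ψ) (hψ : ψ ∈ P) :
      IsChild ⟨ψ, t ψ hψ⟩ ⟨φ, .rule hP t⟩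

instance : IsWellFounded (Σ φ, ProofTree R Γ φ) IsChild := by
  refine ⟨⟨fun ⟨φ, t⟩ => ?_⟩⟩
  induction t with
  | ax | hyp => exact ⟨_, nofun⟩
  | rule hP t ih => exact ⟨_, fun | _, .mk _ _ hψ => ih _ hψ⟩

theorem derivable (t : ProofTree R Γ φ) : Derivable R Γ φ := by
  refine derivable_of_isWellFounded (r := IsChild) Sigma.fst ?_ ⟨φ, t⟩
  rintro ⟨ψ, h | h | ⟨hP, t⟩⟩
  · exact .inl h
  · exact .inr (.inl h)
  · exact .inr (.inr ⟨_, hP, fun χ hχ => ⟨⟨χ, t χ hχ⟩, .mk hP t hχ, rfl⟩⟩)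

theorem closedUnder_setOf_nonempty : ClosedUnder R {φ | Nonempty (ProofTree R Γ φ)} :=
  fun _ _ hP ht => ⟨.rule hP fun _ hψ => (ht hψ).some⟩

end ProofTree

theorem derivable_iff_forall_closedUnder :
    Derivable R Γ φ ↔ ∀ T : Set Fm, (∀ ψ, S5Axiom ψ → ψ ∈ T) → Γ ⊆ T → ClosedUnder R T → φ ∈ T := by
  refine ⟨fun h T hax hΓ hR => h.mem_of_closedUnder hax hΓ hR, fun h => ?_⟩
  obtain ⟨t⟩ := h {ψ | Nonempty (ProofTree R Γ ψ)} (fun _ hψ => ⟨.ax hψ⟩) (fun _ hψ => ⟨.hyp hψ⟩)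
    ProofTree.closedUnder_setOf_nonempty
  exact t.derivable

end Derivable

/-- Theories of `S5(Ł)`: sets of formulas that contain its axioms and are closed under its rules. -/
structure IsS5Theory (T : Set Fm) : Prop where
  of_axiom {φ : Fm} : S5Axiom φ → φ ∈ T
  closedUnder : ClosedUnder S5Rule T

theorem derivable_s5Rule_or_iff {R : Set Fm → Fm → Prop} {Γ : Set Fm} {φ : Fm} :
    Derivable (fun P ψ => S5Rule P ψ ∨ R P ψ) Γ φ ↔
      ∀ T, IsS5Theory T → Γ ⊆ T → ClosedUnder R T → φ ∈ T := by
  simp only [derivable_iff_forall_closedUnder, closedUnder_or_iff]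
  exact ⟨fun h T hT hΓ hR => h T (fun _ => hT.of_axiom) hΓ ⟨hT.closedUnder, hR⟩,
    fun h T hax hΓ hR => h T ⟨hax _, hR.1⟩ hΓ hR.2⟩

namespace IsS5Theory

section Deduction

variable {T : Set Fm} (hT : IsS5Theory T) {φ ψ χ θ ν : Fm}
include hT

theorem of_lukAxiom (h : LukAxiom φ) : φ ∈ T := hT.of_axiom (.luk h)

theorem mp (hφ : φ ∈ T) (h : φ.imp ψ ∈ T) : ψ ∈ T :=
  hT.closedUnder (.modusPonens φ ψ) (Set.pair_subset hφ h)

theorem nec (hφ : φ ∈ T) : φ.box ∈ T :=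
  hT.closedUnder (.necessitation φ) (Set.singleton_subset_iff.2 hφ)

theorem imp_trans (h : φ.imp ψ ∈ T) (h' : ψ.imp χ ∈ T) : φ.imp χ ∈ T :=
  hT.mp h' (hT.mp h (hT.of_lukAxiom (.suffixing φ ψ χ)))

theorem imp_imp_iff : φ.imp (ψ.imp χ) ∈ T ↔ (φ.star ψ).imp χ ∈ T :=
  ⟨fun h => hT.mp h (hT.of_lukAxiom (.importation φ ψ χ)),
    fun h => hT.mp h (hT.of_lukAxiom (.exportation φ ψ χ))⟩

theorem star_imp_left (φ ψ : Fm) : (φ.star ψ).imp φ ∈ T := hT.of_lukAxiom (.weakening φ ψ)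

theorem star_comm (φ ψ : Fm) : (φ.star ψ).imp (ψ.star φ) ∈ T :=
  hT.of_lukAxiom (.commutativity φ ψ)

theorem top_mem : top ∈ T := hT.of_lukAxiom (.explosion bot)

theorem imp_of_mem (h : ψ ∈ T) : φ.imp ψ ∈ T :=
  hT.mp h (hT.imp_imp_iff.2 (hT.star_imp_left ψ φ))

theorem mem_iff_top_imp : φ ∈ T ↔ top.imp φ ∈ T := ⟨hT.imp_of_mem, hT.mp hT.top_mem⟩

theorem imp_refl (φ : Fm) : φ.imp φ ∈ T :=
  hT.mem_iff_top_imp.2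
    (hT.imp_imp_iff.2 (hT.imp_trans (hT.star_comm top φ) (hT.star_imp_left φ top)))

theorem imp_star_top (φ : Fm) : φ.imp (φ.star top) ∈ T :=
  hT.imp_trans (hT.mem_iff_top_imp.2 (hT.imp_imp_iff.2 (hT.imp_refl _))) (hT.star_comm top φ)

theorem star_mono_left (h : φ.imp ψ ∈ T) : (φ.star χ).imp (ψ.star χ) ∈ T :=
  hT.imp_imp_iff.1 (hT.imp_trans h (hT.imp_imp_iff.2 (hT.imp_refl _)))

theorem star_mono (h : φ.imp ψ ∈ T) (h' : χ.imp θ ∈ T) : (φ.star χ).imp (ψ.star θ) ∈ T :=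
  hT.imp_trans (hT.star_mono_left h) (hT.imp_trans (hT.star_comm ψ χ)
    (hT.imp_trans (hT.star_mono_left h') (hT.star_comm θ ψ)))

theorem imp_mono (h : ψ.imp φ ∈ T) (h' : χ.imp θ ∈ T) : (φ.imp χ).imp (ψ.imp θ) ∈ T :=
  hT.imp_imp_iff.2 (hT.imp_trans (hT.star_mono (hT.imp_refl _) h)
    (hT.imp_trans (hT.imp_imp_iff.1 (hT.imp_refl _)) h'))

theorem star_assoc (φ ψ χ : Fm) : ((φ.star ψ).star χ).imp (φ.star (ψ.star χ)) ∈ T :=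
  hT.imp_imp_iff.1 (hT.imp_imp_iff.1 (hT.imp_trans (hT.imp_imp_iff.2 (hT.imp_refl _))
    (hT.of_lukAxiom (.exportation _ _ _))))

theorem star_assoc_symm (φ ψ χ : Fm) : (φ.star (ψ.star χ)).imp ((φ.star ψ).star χ) ∈ T :=
  hT.imp_imp_iff.1 (hT.imp_trans (hT.imp_imp_iff.2 (hT.imp_imp_iff.2 (hT.imp_refl _)))
    (hT.of_lukAxiom (.importation _ _ _)))

theorem box_imp (φ : Fm) : φ.box.imp φ ∈ T := hT.of_axiom (.box_elim φ)

theorem imp_dia (φ : Fm) : φ.imp φ.dia ∈ T := hT.of_axiom (.dia_intro φ)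

theorem imp_box (hν : IsModalComb ν) (h : ν.imp φ ∈ T) : ν.imp φ.box ∈ T :=
  hT.mp (hT.nec h) (hT.of_axiom (.box_imp_right φ hν))

theorem dia_imp (hν : IsModalComb ν) (h : φ.imp ν ∈ T) : φ.dia.imp ν ∈ T :=
  hT.mp (hT.nec h) (hT.of_axiom (.box_imp_left φ hν))

theorem box_mono (h : φ.imp ψ ∈ T) : φ.box.imp ψ.box ∈ T :=
  hT.imp_box (.box φ) (hT.imp_trans (hT.box_imp φ) h)

theorem of_and_left (h : φ.and ψ ∈ T) : φ ∈ T := hT.mp h (hT.star_imp_left _ _)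

theorem of_and_right (h : φ.and ψ ∈ T) : ψ ∈ T :=
  hT.of_and_left (hT.mp h (hT.of_lukAxiom (.divisibility φ ψ)))

end Deduction

variable {T : Set Fm}

/-- Provable equivalence modulo a theory. -/
def setoid (hT : IsS5Theory T) : Setoid Fm where
  r φ ψ := φ.imp ψ ∈ T ∧ ψ.imp φ ∈ T
  iseqv := ⟨fun φ => ⟨hT.imp_refl φ, hT.imp_refl φ⟩, And.symm,
    fun h h' => ⟨hT.imp_trans h.1 h'.1, hT.imp_trans h'.2 h.2⟩⟩

/-- The Lindenbaum algebra of a theory. -/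
def Lindenbaum (hT : IsS5Theory T) : Type := Quotient hT.setoid

/-- The class of a formula in the Lindenbaum algebra. -/
def cls (hT : IsS5Theory T) (φ : Fm) : hT.Lindenbaum := Quotient.mk hT.setoid φ

variable (hT : IsS5Theory T) {φ ψ : Fm}

theorem cls_eq (h : φ.imp ψ ∈ T) (h' : ψ.imp φ ∈ T) : hT.cls φ = hT.cls ψ :=
  Quotient.sound (s := hT.setoid) ⟨h, h'⟩

instance : CommMonoid hT.Lindenbaum where
  mul := Quotient.map₂ star fun _ _ h _ _ h' => ⟨hT.star_mono h.1 h'.1, hT.star_mono h.2 h'.2⟩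
  one := hT.cls top
  mul_assoc := by
    rintro ⟨φ⟩ ⟨ψ⟩ ⟨χ⟩
    exact hT.cls_eq (hT.star_assoc φ ψ χ) (hT.star_assoc_symm φ ψ χ)
  one_mul := by
    rintro ⟨φ⟩
    exact hT.cls_eq (hT.imp_trans (hT.star_comm top φ) (hT.star_imp_left φ top))
      (hT.imp_trans (hT.imp_star_top φ) (hT.star_comm φ top))
  mul_one := by
    rintro ⟨φ⟩
    exact hT.cls_eq (hT.star_imp_left φ top) (hT.imp_star_top φ)
  mul_comm := by
    rintro ⟨φ⟩ ⟨ψ⟩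
    exact hT.cls_eq (hT.star_comm φ ψ) (hT.star_comm ψ φ)

instance : PartialOrder hT.Lindenbaum where
  le := Quotient.lift₂ (fun φ ψ => φ.imp ψ ∈ T) fun _ _ _ _ h h' =>
    propext ⟨fun H => hT.imp_trans h.2 (hT.imp_trans H h'.1),
      fun H => hT.imp_trans h.1 (hT.imp_trans H h'.2)⟩
  le_refl := by rintro ⟨φ⟩; exact hT.imp_refl φ
  le_trans := by rintro ⟨φ⟩ ⟨ψ⟩ ⟨χ⟩; exact hT.imp_trans
  le_antisymm := by rintro ⟨φ⟩ ⟨ψ⟩; exact hT.cls_eq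

instance : MVAlgebra hT.Lindenbaum where
  bot := hT.cls bot
  bot_le := by rintro ⟨φ⟩; exact hT.of_lukAxiom (.explosion φ)
  himp := Quotient.map₂ imp fun _ _ h _ _ h' => ⟨hT.imp_mono h.2 h'.1, hT.imp_mono h.1 h'.2⟩
  le_himp_iff_mul_le := by rintro ⟨φ⟩ ⟨ψ⟩ ⟨χ⟩; exact hT.imp_imp_iff
  le_one := by rintro ⟨φ⟩; exact hT.imp_of_mem hT.top_mem
  divisibility := by rintro ⟨φ⟩ ⟨ψ⟩; exact hT.of_lukAxiom (.divisibility φ ψ)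
  prelinearity := by rintro ⟨φ⟩ ⟨ψ⟩ ⟨χ⟩; exact hT.of_lukAxiom (.prelinearity φ ψ χ)
  involution := by rintro ⟨φ⟩; exact hT.of_lukAxiom (.involution φ)

open ResiduatedMonoid MVAlgebra S5MVAlgebra

theorem cls_dia (φ : Fm) : hT.cls φ.dia = hT.cls φ.neg.box.neg := by
  refine hT.cls_eq (hT.dia_imp (IsModalComb.box _).neg ?_) ?_
  · have h : hT.cls φ.neg.box ≤ (hT.cls φ)ᶜ := hT.box_imp φ.neg
    exact le_compl_swap h
  · have neg_dia_le : (hT.cls φ.dia)ᶜ ≤ (hT.cls φ)ᶜ := compl_le_compl_of_le (hT.imp_dia φ)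
    have h : (hT.cls φ.dia)ᶜ ≤ hT.cls φ.neg.box := hT.imp_box (IsModalComb.dia φ).neg neg_dia_le
    exact compl_le_swap h

theorem cls_dia_star_self (φ : Fm) : hT.cls (φ.star φ).dia = hT.cls φ.dia * hT.cls φ.dia :=
  hT.cls_eq (hT.of_and_left (hT.of_axiom (.dia_star φ)))
    (hT.of_and_right (hT.of_axiom (.dia_star φ)))

theorem cls_box_box_imp (φ ψ : Fm) : hT.cls (φ.box.imp ψ).box = hT.cls (φ.box.imp ψ.box) :=
  hT.cls_eq (hT.of_axiom (.box_imp_right ψ (.box φ)))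
    (hT.imp_box ((IsModalComb.box φ).imp (.box ψ)) (hT.imp_mono (hT.imp_refl _) (hT.box_imp ψ)))

instance : S5MVAlgebra hT.Lindenbaum where
  box := Quotient.map box fun _ _ h => ⟨hT.box_mono h.1, hT.box_mono h.2⟩
  box_le := by rintro ⟨φ⟩; exact hT.box_imp φ
  box_box_himp := by rintro ⟨φ⟩ ⟨ψ⟩; exact hT.cls_box_box_imp φ ψ
  compl_box_compl_mul_self := by
    rintro ⟨φ⟩
    have h := hT.cls_dia_star_self φ
    rw [cls_dia, cls_dia] at h
    exact h

theorem cls_imp (φ ψ : Fm) : hT.cls (φ.imp ψ) = hT.cls φ ⇨ hT.cls ψ := rfl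

theorem cls_or (φ ψ : Fm) : hT.cls (φ.or ψ) = hT.cls φ ⊔ hT.cls ψ := rfl

theorem cls_pow (φ : Fm) : ∀ n : ℕ, hT.cls (φ.pow n) = hT.cls φ ^ n
  | 0 => (pow_zero _).symm
  | 1 => (pow_one _).symm
  | n + 2 => by rw [pow_succ, ← cls_pow φ (n + 1)]; rfl

theorem cls_eq_one_iff : hT.cls φ = 1 ↔ φ ∈ T :=
  one_le_iff_eq_one.symm.trans hT.mem_iff_top_imp.symm

theorem or_imp_pow_mem_iff {φ α β : Fm} {n : ℕ} :
    φ.or (α.imp (β.pow n)) ∈ T ↔ hT.cls φ ⊔ (hT.cls α ⇨ hT.cls β ^ n) = 1 := by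
  rw [← cls_pow, ← cls_imp, ← cls_or, cls_eq_one_iff]

theorem closedUnder_infRule_iff :
    ClosedUnder InfRule T ↔ SatisfiesInf hT.Lindenbaum := by
  constructor
  · rintro h ⟨φ⟩ ⟨α⟩ ⟨β⟩ hn
    exact hT.cls_eq_one_iff.2
      (h (.mk φ α β) (Set.range_subset_iff.2 fun n => hT.or_imp_pow_mem_iff.2 (hn n)))
  · rintro h _ _ ⟨φ, α, β⟩ hP
    exact hT.cls_eq_one_iff.1
      (h (hT.cls φ) (hT.cls α) (hT.cls β) fun n => hT.or_imp_pow_mem_iff.1 (hP ⟨n, rfl⟩))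

theorem closedUnder_boxInfRule_iff :
    ClosedUnder BoxInfRule T ↔ SatisfiesBoxInf hT.Lindenbaum := by
  constructor
  · rintro h ⟨φ⟩ ⟨α⟩ ⟨β⟩ hn
    exact hT.cls_eq_one_iff.2
      (h (.mk φ α β) (Set.range_subset_iff.2 fun n => hT.or_imp_pow_mem_iff.2 (hn n)))
  · rintro h _ _ ⟨φ, α, β⟩ hP
    exact hT.cls_eq_one_iff.1
      (h (hT.cls φ) (hT.cls α) (hT.cls β) fun n => hT.or_imp_pow_mem_iff.1 (hP ⟨n, rfl⟩))

include hT in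
theorem closedUnder_boxInfRule_iff_closedUnder_infRule :
    ClosedUnder BoxInfRule T ↔ ClosedUnder InfRule T := by
  rw [hT.closedUnder_boxInfRule_iff, hT.closedUnder_infRule_iff, satisfiesBoxInf_iff_satisfiesInf]

end IsS5Theory

end Fm

theorem mainTheorem12 (Γ : Set Fm) (φ : Fm) : Fm.S5LukInf Γ φ ↔ Fm.S5LukInf' Γ φ := by
  rw [Fm.S5LukInf, Fm.S5LukInf', Fm.derivable_s5Rule_or_iff, Fm.derivable_s5Rule_or_iff]
  exact forall₂_congr fun T hT => by rw [hT.closedUnder_boxInfRule_iff_closedUnder_infRule]
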